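/- Let $\mathbf{Ban}$ be the category whose objects are the real Banach spaces and whose morphisms $V\to U$ are the short operators, i.e. the bounded linear operators $T:V\to U$ with operator norm $\|T\|\le 1$. An \emph{autonomous category} is a symmetric monoidal category in which, for every object $X$, the functor $-\otimes X$ has a right adjoint $X\multimap -$. A \emph{$\mathbf{Met}$-enriched autonomous category} is an autonomous category $\mathcal C$ in which every hom-set $\mathcal C(X,Y)$ carries an (extended) metric $d$ such that 1. composition is non-expansive: $d(g f,g' f')\le d(f,f')+d(g,g')$ for all $f,f'\in\mathcal C(X,Y)$ and $g,g'\in\mathcal C(Y,Z)$; 2. the tensor is non-expansive: $d(f\otimes f',g\otimes g')\le d(f,g)+d(f',g')$ for all $f,g\in\mathcal C(X,Y)$ and $f',g'\in\mathcal C(X',Y')$; 3. the natural bijections $\mathcal C(Y\otimes X,Z)\cong\mathcal C(Y,X\multimap Z)$ of the adjunctions $(-\otimes X)\dashv(X\multimap -)$ are isometries. **Theorem.** $\mathbf{Ban}$ is a $\mathbf{Met}$-enriched autonomous category, where - $V\otimes U$ is the projective tensor product $V\mathbin{\hat\otimes_\pi}U$, i.e. the completion of the algebraic tensor product in the norm $\pi(x)=\inf\{\sum_i\|v_i\|\|u_i\|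 : x=\sum_i v_i\otimes u_i\}$, and $T\otimes S$ is the short operator determined by $v\otimes u\mapsto Tv\otimes Su$; - the unit is $\mathbb R$, and the associator, unitors and symmetry are the short operators determined by $(v\otimes u)\otimes w\mapsto v\otimes(u\otimes w)$, $r\otimes v\mapsto rv$, $v\otimes r\mapsto rv$ and $v\otimes u\mapsto u\otimes v$; - $V\multimap U$ is the Banach space of all bounded operators $V\to U$ with the operator norm, the functor $V\multimap -$ sends $S$ to $T\mapsto ST$, and the adjunction sends $f:W\mathbin{\hat\otimes_\pi}V\to U$ to $w\mapsto(v\mapsto f(w\otimes v))$; - the metric on $\mathbf{Ban}(V,U)$ is $d(S,T)=\|S-T\|$. -/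

import Mathlib

open CategoryTheory MonoidalCategory
open scoped TensorProduct

universe v u

noncomputable section

set_option linter.unusedSectionVars false

/-! ### Autonomous categories -/

/-- An autonomous category, i.e. a symmetric monoidal category in which every functor
`- ⊗ X` has a chosen right adjoint `X ⊸ -`. -/
structure AutonomousCategory (C : Type u) [Category.{v} C] where
  [monoidal : MonoidalCategory C]
  [symmetric : SymmetricCategory C]
  /-- `ihom X` is the functor `X ⊸ -`. -/
  ihom : C → C ⥤ C
  adj : ∀ X : C, tensorRight X ⊣ ihom X

/-- The operations underlying an autonomous category, without the equations between them. -/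
structure AutonomousData (C : Type u) [Category.{v} C] where
  tensor : MonoidalCategoryStruct C
  braiding : ∀ X Y : C, X ⊗ Y ≅ Y ⊗ X
  ihom : C → C ⥤ C
  curry : ∀ X Y Z : C, (Y ⊗ X ⟶ Z) ≃ (Y ⟶ (ihom X).obj Z)

/-- The operations of an autonomous category. -/
def AutonomousCategory.data {C : Type u} [Category.{v} C] (A : AutonomousCategory C) :
    AutonomousData C :=
  letI := A.monoidal
  letI := A.symmetric
  { tensor := inferInstance
    braiding := fun X Y => BraidedCategory.braiding X Y
    ihom := A.ihom
    curry := fun X Y Z => (A.adj X).homEquiv Y Z }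

/-! ### Enrichment over `Met` -/

/-- A `Met`-enriched category: the hom-sets are extended metric spaces and composition is
non-expansive for the tensor of `Met`, that is, for the sum of the two distances on
`C(X, Y) × C(Y, Z)`. -/
structure MetEnrichment (C : Type u) [Category.{v} C] where
  [emetric : ∀ X Y : C, EMetricSpace (X ⟶ Y)]
  edist_comp_le : ∀ {X Y Z : C} (f f' : X ⟶ Y) (g g' : Y ⟶ Z),
    edist (f ≫ g) (f' ≫ g') ≤ edist f f' + edist g g'

/-- A `Met`-enriched autonomous category: an autonomous category that is `Met`-enriched, such
that the bifunctor `⊗` is non-expansive on hom-sets (with the sum metric on a product of two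
hom-sets) and the natural bijections `C(Y ⊗ X, Z) ≃ C(Y, X ⊸ Z)` of the adjunctions
`- ⊗ X ⊣ X ⊸ -` are isomorphisms of metric spaces. -/
structure MetEnrichedAutonomousCategory (C : Type u) [Category.{v} C] extends
    AutonomousCategory C, MetEnrichment C where
  edist_tensorHom_le : ∀ {X Y X' Y' : C} (f g : X ⟶ Y) (f' g' : X' ⟶ Y'),
    edist (f ⊗ₘ f') (g ⊗ₘ g') ≤ edist f g + edist f' g'
  isometry_homEquiv : ∀ X Y Z : C, Isometry ((adj X).homEquiv Y Z)

/-! ### The projective tensor product -/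

section Projective

variable (V : Type*) (U : Type*) [NormedAddCommGroup V] [NormedSpace ℝ V]
  [NormedAddCommGroup U] [NormedSpace ℝ U]

/-- The algebraic tensor product of two normed spaces, to be equipped with the projective
norm. -/
def AlgProjTensor : Type _ := V ⊗[ℝ] U

instance : AddCommGroup (AlgProjTensor V U) := inferInstanceAs (AddCommGroup (V ⊗[ℝ] U))

instance : Module ℝ (AlgProjTensor V U) := inferInstanceAs (Module ℝ (V ⊗[ℝ] U))

/-- The identity `V ⊗ U → V ⊗ U`, into the copy that carries the projective norm. -/
def toAlgProj : V ⊗[ℝ] U ≃ₗ[ℝ] AlgProjTensor V U := LinearEquiv.refl ℝ (V ⊗[ℝ] U)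

variable {V U}

/-- The ways of writing `x` as a finite sum of elementary tensors. -/
abbrev TensorRep (x : V ⊗[ℝ] U) : Type _ :=
  {l : List (V × U) // (l.map fun p => p.1 ⊗ₜ[ℝ] p.2).sum = x}

/-- The number `∑ ‖vᵢ‖ ‖uᵢ‖` attached to a representation `∑ vᵢ ⊗ uᵢ`. -/
def repCost (l : List (V × U)) : ℝ := (l.map fun p => ‖p.1‖ * ‖p.2‖).sum

/-- The projective norm `π(x) = inf {∑ ‖vᵢ‖ ‖uᵢ‖ : x = ∑ vᵢ ⊗ uᵢ}`. -/
def projNorm (x : V ⊗[ℝ] U) : ℝ := ⨅ r : TensorRep x, repCost r.1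

theorem repCost_nonneg (l : List (V × U)) : 0 ≤ repCost l := by
  refine List.sum_nonneg fun a ha => ?_
  obtain ⟨p, -, rfl⟩ := List.mem_map.1 ha
  positivity

theorem projNorm_bddBelow (x : V ⊗[ℝ] U) :
    BddBelow (Set.range fun r : TensorRep x => repCost r.1) :=
  ⟨0, by rintro _ ⟨r, rfl⟩; exact repCost_nonneg _⟩

theorem projNorm_le (l : List (V × U)) :
    projNorm ((l.map fun p => p.1 ⊗ₜ[ℝ] p.2).sum) ≤ repCost l :=
  ciInf_le (projNorm_bddBelow _) (⟨l, rfl⟩ : TensorRep _)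

theorem smul_rep (a : ℝ) (l : List (V × U)) :
    ((l.map fun p => (a • p.1, p.2)).map fun p => p.1 ⊗ₜ[ℝ] p.2).sum =
      a • (l.map fun p => p.1 ⊗ₜ[ℝ] p.2).sum := by
  induction l with
  | nil => simp
  | cons p l ih =>
    simp only [List.map_cons, List.sum_cons, smul_add, TensorProduct.smul_tmul'] at ih ⊢
    rw [ih]

theorem smul_repCost (a : ℝ) (l : List (V × U)) :
    repCost (l.map fun p => (a • p.1, p.2)) = |a| * repCost l := by
  induction l with
  | nil => simp [repCost]
  | cons p l ih =>
    simp only [repCost, List.map_cons, List.sum_cons, norm_smul, Real.norm_eq_abs] at ih ⊢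
    rw [ih]; ring

instance (x : V ⊗[ℝ] U) : Nonempty (TensorRep x) := by
  induction x using TensorProduct.induction_on with
  | zero => exact ⟨⟨[], rfl⟩⟩
  | tmul v w => exact ⟨⟨[(v, w)], by simp⟩⟩
  | add x y hx hy =>
    obtain ⟨⟨l, hl⟩⟩ := hx
    obtain ⟨⟨m, hm⟩⟩ := hy
    exact ⟨⟨l ++ m, by simp [hl, hm]⟩⟩

theorem projNorm_zero : projNorm (0 : V ⊗[ℝ] U) = 0 :=
  le_antisymm (by simpa [repCost] using projNorm_le ([] : List (V × U)))
    (le_ciInf fun r => repCost_nonneg _)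

theorem projNorm_add_le (x y : V ⊗[ℝ] U) : projNorm (x + y) ≤ projNorm x + projNorm y := by
  refine le_ciInf_add_ciInf fun r s => ?_
  obtain ⟨l, rfl⟩ := r
  obtain ⟨m, rfl⟩ := s
  simpa [repCost] using projNorm_le (l ++ m)

theorem projNorm_smul_le (a : ℝ) (x : V ⊗[ℝ] U) : projNorm (a • x) ≤ ‖a‖ * projNorm x := by
  rw [projNorm.eq_def x, Real.mul_iInf_of_nonneg (norm_nonneg _)]
  refine le_ciInf fun r => ?_
  obtain ⟨l, rfl⟩ := r
  have h := projNorm_le (l.map fun p => (a • p.1, p.2))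
  rw [smul_rep, smul_repCost] at h
  exact h

variable (V U) in
/-- The projective norm as a seminorm. -/
def projSeminorm : Seminorm ℝ (AlgProjTensor V U) :=
  Seminorm.ofSMulLE (fun x => projNorm ((toAlgProj V U).symm x)) projNorm_zero projNorm_add_le
    projNorm_smul_le

instance : SeminormedAddCommGroup (AlgProjTensor V U) :=
  (projSeminorm V U).toAddGroupSeminorm.toSeminormedAddCommGroup

instance : NormedSpace ℝ (AlgProjTensor V U) := ⟨projNorm_smul_le⟩

variable (V U) in
/-- The projective tensor product: the completion of the algebraic tensor product with respect
to the projective norm. -/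
abbrev ProjTensor : Type _ := UniformSpace.Completion (AlgProjTensor V U)

theorem norm_toAlgProj (x : V ⊗[ℝ] U) : ‖toAlgProj V U x‖ = projNorm x := rfl

variable (V U) in
/-- The canonical bounded bilinear map `(v, u) ↦ v ⊗ u`. -/
def ptmul : V →L[ℝ] U →L[ℝ] ProjTensor V U :=
  LinearMap.mkContinuous₂
    ((TensorProduct.mk ℝ V U).compr₂
      ((UniformSpace.Completion.toComplL (𝕜 := ℝ) (E := AlgProjTensor V U)).toLinearMap ∘ₗ
        (toAlgProj V U).toLinearMap)) 1
    (fun v w => by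
      have h := projNorm_le [(v, w)]
      simp only [repCost, List.map_cons, List.map_nil, List.sum_cons, List.sum_nil,
        add_zero] at h
      rw [one_mul]
      exact (UniformSpace.Completion.norm_coe (toAlgProj V U (v ⊗ₜ[ℝ] w))).trans_le h)

theorem ptmul_apply (v : V) (w : U) : ptmul V U v w = ↑(toAlgProj V U (v ⊗ₜ[ℝ] w)) := rfl

theorem norm_ptmul_le : ‖ptmul V U‖ ≤ 1 :=
  LinearMap.mkContinuous₂_norm_le _ zero_le_one _

variable {W : Type*} [NormedAddCommGroup W] [NormedSpace ℝ W]

theorem ProjTensor.ext {S T : ProjTensor V U →L[ℝ] W}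
    (h : ∀ v w, S (ptmul V U v w) = T (ptmul V U v w)) : S = T := by
  refine ContinuousLinearMap.coeFn_injective
    (UniformSpace.Completion.ext S.continuous T.continuous fun x => ?_)
  obtain ⟨x, rfl⟩ := (toAlgProj V U).surjective x
  induction x using TensorProduct.induction_on with
  | zero => rw [map_zero, UniformSpace.Completion.coe_zero, map_zero, map_zero]
  | tmul v w => exact h v w
  | add x y hx hy =>
    rw [map_add, UniformSpace.Completion.coe_add, map_add, map_add, hx, hy]

theorem norm_lift_le (B : V →L[ℝ] U →L[ℝ] W) (x : V ⊗[ℝ] U) :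
    ‖TensorProduct.lift (B.toLinearMap₁₂) x‖ ≤ ‖B‖ * projNorm x := by
  rw [projNorm, Real.mul_iInf_of_nonneg (norm_nonneg B)]
  refine le_ciInf fun r => ?_
  obtain ⟨l, rfl⟩ := r
  induction l with
  | nil => simp [repCost]
  | cons p l ih =>
    simp only [repCost, List.map_cons, List.sum_cons, map_add, mul_add] at ih ⊢
    refine (norm_add_le _ _).trans (add_le_add ?_ ih)
    rw [← mul_assoc]
    simpa using B.le_opNorm₂ p.1 p.2

/-- The bounded operator on the algebraic tensor product with `v ⊗ u ↦ B v u`. -/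
def algLift (B : V →L[ℝ] U →L[ℝ] W) : AlgProjTensor V U →L[ℝ] W :=
  LinearMap.mkContinuous (TensorProduct.lift B.toLinearMap₁₂ ∘ₗ (toAlgProj V U).symm.toLinearMap)
    ‖B‖ (fun x => norm_lift_le B ((toAlgProj V U).symm x))

theorem norm_algLift_le (B : V →L[ℝ] U →L[ℝ] W) : ‖algLift B‖ ≤ ‖B‖ :=
  LinearMap.mkContinuous_norm_le _ (norm_nonneg B) _

variable [CompleteSpace W]

/-- The bounded operator on the projective tensor product with `v ⊗ u ↦ B v u`. -/
def projLift (B : V →L[ℝ] U →L[ℝ] W) : ProjTensor V U →L[ℝ] W :=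
  (algLift B).extend (UniformSpace.Completion.toComplL (𝕜 := ℝ) (E := AlgProjTensor V U))

@[simp]
theorem projLift_ptmul (B : V →L[ℝ] U →L[ℝ] W) (v : V) (w : U) :
    projLift B (ptmul V U v w) = B v w :=
  (ContinuousLinearMap.extend_eq (algLift B)
    (e := UniformSpace.Completion.toComplL (𝕜 := ℝ) (E := AlgProjTensor V U))
    UniformSpace.Completion.denseRange_coe
    (UniformSpace.Completion.isUniformInducing_coe _) (toAlgProj V U (v ⊗ₜ[ℝ] w))).trans
    (TensorProduct.lift.tmul v w)

theorem norm_projLift_le (B : V →L[ℝ] U →L[ℝ] W) : ‖projLift B‖ ≤ ‖B‖ := by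
  refine ContinuousLinearMap.opNorm_le_bound _ (norm_nonneg B) fun x => ?_
  induction x using UniformSpace.Completion.induction_on with
  | hp => exact isClosed_le (by fun_prop) (by fun_prop)
  | ih x =>
    rw [UniformSpace.Completion.norm_coe]
    refine le_of_eq_of_le (congrArg norm ?_)
      ((algLift B).le_of_opNorm_le (norm_algLift_le B) x)
    exact ContinuousLinearMap.extend_eq (algLift B)
      (e := UniformSpace.Completion.toComplL (𝕜 := ℝ) (E := AlgProjTensor V U))
      UniformSpace.Completion.denseRange_coe (UniformSpace.Completion.isUniformInducing_coe _) x

end Projective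

/-! ### The category of Banach spaces and short operators -/

/-- Real Banach spaces. -/
structure Ban : Type (u + 1) where
  carrier : Type u
  [normed : NormedAddCommGroup carrier]
  [space : NormedSpace ℝ carrier]
  [complete : CompleteSpace carrier]

namespace Ban

instance : CoeSort Ban.{u} (Type u) := ⟨Ban.carrier⟩

attribute [instance] Ban.normed Ban.space Ban.complete

/-- Short operators: bounded linear operators of operator norm at most `1`. -/
@[ext]
structure Hom (V U : Ban.{u}) where
  clm : V →L[ℝ] U
  short : ‖clm‖ ≤ 1

instance : Category.{u} Ban.{u} where
  Hom := Hom
  id V := ⟨ContinuousLinearMap.id ℝ V, ContinuousLinearMap.norm_id_le⟩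
  comp S T := ⟨T.clm.comp S.clm, (T.clm.opNorm_comp_le S.clm).trans
    (mul_le_one₀ T.short (norm_nonneg _) S.short)⟩

@[ext]
theorem hom_ext {V U : Ban.{u}} {S T : V ⟶ U} (h : S.clm = T.clm) : S = T := Hom.ext h

@[simp] theorem id_clm (V : Ban.{u}) : Hom.clm (𝟙 V) = ContinuousLinearMap.id ℝ V := rfl

@[simp] theorem comp_clm {V U W : Ban.{u}} (S : V ⟶ U) (T : U ⟶ W) :
    (S ≫ T).clm = T.clm.comp S.clm := rfl

/-- The projective tensor product `V ⊗̂ U`. -/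
def tensor (V U : Ban.{u}) : Ban.{u} := ⟨ProjTensor V U⟩

/-- The elementary tensors, as a bounded bilinear map. -/
def tmul (V U : Ban.{u}) : V →L[ℝ] U →L[ℝ] tensor V U := ptmul V U

theorem tmul_short (V U : Ban.{u}) (v : V) : ‖tmul V U v‖ ≤ ‖v‖ := by
  simpa using (tmul V U).le_of_opNorm_le norm_ptmul_le v

/-- A bilinear map of norm at most `1` induces a short operator on the projective tensor
product. -/
def lift {V U W : Ban.{u}} (B : V →L[ℝ] U →L[ℝ] W) (hB : ‖B‖ ≤ 1) : tensor V U ⟶ W :=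
  ⟨projLift B, (norm_projLift_le B).trans hB⟩

@[simp] theorem lift_tmul {V U W : Ban.{u}} (B : V →L[ℝ] U →L[ℝ] W) (hB : ‖B‖ ≤ 1) (v : V)
    (w : U) : (lift B hB).clm (tmul V U v w) = B v w := projLift_ptmul B v w

theorem op_ext {V U : Ban.{u}} {W : Type*} [NormedAddCommGroup W] [NormedSpace ℝ W]
    {S T : tensor V U →L[ℝ] W} (h : ∀ v w, S (tmul V U v w) = T (tmul V U v w)) : S = T :=
  ProjTensor.ext h

/-- The internal hom: all bounded operators `V → U` with the operator norm. -/
def hom (V U : Ban.{u}) : Ban.{u} := ⟨V →L[ℝ] U⟩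

/-- The tensor unit `ℝ`. -/
def unit : Ban.{u} := ⟨ULift.{u} ℝ⟩

/-- `T ⊗̂ S : v ⊗ u ↦ T v ⊗ S u`. -/
def tensorMap {V V' U U' : Ban.{u}} (T : V ⟶ V') (S : U ⟶ U') :
    tensor V U ⟶ tensor V' U' :=
  lift (((ContinuousLinearMap.compL ℝ U U' (tensor V' U')).flip S.clm).comp
      ((tmul V' U').comp T.clm)) <| by
    refine ContinuousLinearMap.opNorm_le_bound _ zero_le_one fun v => ?_
    refine (ContinuousLinearMap.opNorm_comp_le (tmul V' U' (T.clm v)) S.clm).trans ?_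
    calc _ ≤ ‖T.clm v‖ * 1 := mul_le_mul (tmul_short _ _ _) S.short (norm_nonneg _) (norm_nonneg _)
      _ ≤ 1 * ‖v‖ := by simpa using T.clm.le_of_opNorm_le T.short v

@[simp] theorem tensorMap_tmul {V V' U U' : Ban.{u}} (T : V ⟶ V') (S : U ⟶ U') (v : V)
    (w : U) : (tensorMap T S).clm (tmul V U v w) = tmul V' U' (T.clm v) (S.clm w) := by
  simp [tensorMap]

/-- Currying: `f : V ⊗̂ U → W` corresponds to `v ↦ (u ↦ f (v ⊗ u))`. -/
def curry (U V W : Ban.{u}) : (tensor V U ⟶ W) ≃ (V ⟶ hom U W) where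
  toFun f := ⟨(ContinuousLinearMap.compL ℝ U (tensor V U) W f.clm).comp (tmul V U), by
    refine ContinuousLinearMap.opNorm_le_bound _ zero_le_one fun v => ?_
    refine (ContinuousLinearMap.opNorm_comp_le f.clm (tmul V U v)).trans ?_
    exact mul_le_mul f.short (tmul_short _ _ _) (norm_nonneg _) zero_le_one⟩
  invFun g := lift g.clm g.short
  left_inv f := by
    ext1
    exact op_ext fun v w => lift_tmul _ _ v w
  right_inv g := by
    ext1
    refine ContinuousLinearMap.ext fun v => ContinuousLinearMap.ext fun w => ?_
    exact lift_tmul g.clm g.short v w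

@[simp] theorem curry_apply {U V W : Ban.{u}} (f : tensor V U ⟶ W) (v : V) :
    (curry U V W f).clm v = f.clm.comp (tmul V U v) := rfl

@[simp] theorem curry_symm_tmul {U V W : Ban.{u}} (g : V ⟶ hom U W) (v : V) (w : U) :
    ((curry U V W).symm g).clm (tmul V U v w) = DFunLike.coe (F := U →L[ℝ] W) (g.clm v) w :=
  lift_tmul g.clm g.short v w

/-- The functor `V ⊸ -`, sending `S` to `T ↦ S T`. -/
def ihom (V : Ban.{u}) : Ban.{u} ⥤ Ban.{u} where
  obj U := hom V U
  map {U U'} S := ⟨ContinuousLinearMap.compL ℝ V U U' S.clm, by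
    refine ContinuousLinearMap.opNorm_le_bound _ zero_le_one fun T => ?_
    refine (ContinuousLinearMap.opNorm_comp_le S.clm T).trans ?_
    exact mul_le_mul_of_nonneg_right S.short (norm_nonneg _)⟩

/-- The symmetry `v ⊗ u ↦ u ⊗ v`. -/
def swap (V U : Ban.{u}) : tensor V U ⟶ tensor U V :=
  lift (tmul U V).flip ((ContinuousLinearMap.opNorm_flip _).trans_le norm_ptmul_le)

@[simp] theorem swap_tmul (V U : Ban.{u}) (v : V) (w : U) :
    (swap V U).clm (tmul V U v w) = tmul U V w v := by
  simp [swap]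

def braiding (V U : Ban.{u}) : tensor V U ≅ tensor U V where
  hom := swap V U
  inv := swap U V
  hom_inv_id := by ext1; exact op_ext fun v w => by simp
  inv_hom_id := by ext1; exact op_ext fun v w => by simp

/-- `(v ⊗ u) ⊗ w ↦ v ⊗ (u ⊗ w)`, obtained from `v ↦ u ↦ w ↦ v ⊗ (u ⊗ w)`. -/
def assocHom (V U W : Ban.{u}) : tensor (tensor V U) W ⟶ tensor V (tensor U W) :=
  (curry W (tensor V U) _).symm <| (curry U V _).symm <|
    curry (tensor U W) V _ (𝟙 _) ≫
      ⟨((ContinuousLinearMap.compL ℝ U (W →L[ℝ] tensor U W)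
        (W →L[ℝ] tensor V (tensor U W))).flip
          (tmul U W)).comp (ContinuousLinearMap.compL ℝ W (tensor U W) (tensor V (tensor U W))), by
        refine ContinuousLinearMap.opNorm_le_bound _ zero_le_one fun f => ?_
        refine ContinuousLinearMap.opNorm_le_bound _ (by positivity) fun x => ?_
        refine (ContinuousLinearMap.opNorm_comp_le f (tmul U W x)).trans ?_
        rw [one_mul]
        exact mul_le_mul_of_nonneg_left (tmul_short _ _ _) (norm_nonneg _)⟩

@[simp] theorem assocHom_tmul (V U W : Ban.{u}) (x : V) (y : U) (z : W) :
    (assocHom V U W).clm (tmul _ _ (tmul _ _ x y) z) = tmul _ _ x (tmul _ _ y z) := by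
  rw [assocHom, curry_symm_tmul, curry_symm_tmul]
  rfl

/-- `v ⊗ (u ⊗ w) ↦ (v ⊗ u) ⊗ w`. -/
def assocInv (V U W : Ban.{u}) : tensor V (tensor U W) ⟶ tensor (tensor V U) W :=
  swap _ _ ≫ tensorMap (swap _ _) (𝟙 _) ≫ assocHom W U V ≫ swap _ _ ≫
    tensorMap (swap _ _) (𝟙 _)

@[simp] theorem assocInv_tmul (V U W : Ban.{u}) (x : V) (y : U) (z : W) :
    (assocInv V U W).clm (tmul _ _ x (tmul _ _ y z)) = tmul _ _ (tmul _ _ x y) z := by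
  simp [assocInv]

theorem op_ext₃ {V U W : Ban.{u}} {X : Ban.{u}} {S T : tensor (tensor V U) W ⟶ X}
    (h : ∀ x y z, S.clm (tmul _ _ (tmul _ _ x y) z) = T.clm (tmul _ _ (tmul _ _ x y) z)) :
    S = T := by
  refine (curry _ _ _).injective ((curry _ _ _).injective ?_)
  ext1
  exact ContinuousLinearMap.ext fun x => ContinuousLinearMap.ext fun y =>
    ContinuousLinearMap.ext fun z => h x y z

theorem op_ext₃' {V U W : Ban.{u}} {X : Ban.{u}} {S T : tensor V (tensor U W) ⟶ X}
    (h : ∀ x y z, S.clm (tmul _ _ x (tmul _ _ y z)) = T.clm (tmul _ _ x (tmul _ _ y z))) :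
    S = T := by
  refine (curry _ _ _).injective ?_
  ext1
  exact ContinuousLinearMap.ext fun x => op_ext fun y z => h x y z

def associator (V U W : Ban.{u}) : tensor (tensor V U) W ≅ tensor V (tensor U W) where
  hom := assocHom V U W
  inv := assocInv V U W
  hom_inv_id := op_ext₃ fun x y z => by simp
  inv_hom_id := op_ext₃' fun x y z => by simp

/-- The identification of the unit with the real numbers. -/
def unitVal : unit.{u} →L[ℝ] ℝ :=
  (ContinuousLinearEquiv.ulift (R₁ := ℝ) (M₁ := ℝ)).toContinuousLinearMap

/-- The element `1` of the unit. -/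
def one : unit.{u} := ULift.up (1 : ℝ)

theorem norm_unitVal (r : unit.{u}) : ‖unitVal r‖ = ‖r‖ := rfl

@[simp] theorem unitVal_one : unitVal one.{u} = 1 := rfl

theorem unitVal_smul_one (r : unit.{u}) : unitVal r • one = r :=
  ULift.ext _ _ (mul_one (unitVal r))

/-- `r ⊗ v ↦ r v`. -/
def leftUnitorHom (V : Ban.{u}) : tensor unit V ⟶ V :=
  lift ((ContinuousLinearMap.lsmul ℝ ℝ).comp unitVal) <| by
    refine ContinuousLinearMap.opNorm_le_bound _ zero_le_one fun r => ?_
    refine ContinuousLinearMap.opNorm_le_bound _ (by positivity) fun v => ?_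
    rw [one_mul, ← norm_unitVal]
    exact norm_smul_le (unitVal r) v

@[simp] theorem leftUnitorHom_tmul (V : Ban.{u}) (r : unit.{u}) (v : V) :
    (leftUnitorHom V).clm (tmul unit V r v) = unitVal r • v := by
  simp [leftUnitorHom]

/-- `v ↦ 1 ⊗ v`. -/
def leftUnitorInv (V : Ban.{u}) : V ⟶ tensor unit V :=
  ⟨tmul unit V one, (tmul_short unit V one).trans
    (by rw [← norm_unitVal, unitVal_one, norm_one])⟩

@[simp] theorem leftUnitorInv_apply (V : Ban.{u}) (v : V) :
    (leftUnitorInv V).clm v = tmul unit V one v := rfl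

def leftUnitor (V : Ban.{u}) : tensor unit V ≅ V where
  hom := leftUnitorHom V
  inv := leftUnitorInv V
  hom_inv_id := by
    ext1
    refine op_ext fun r v => ?_
    simp only [comp_clm, id_clm, ContinuousLinearMap.comp_apply, leftUnitorHom_tmul,
      leftUnitorInv_apply, ContinuousLinearMap.id_apply, map_smul]
    conv_rhs => rw [← unitVal_smul_one r, map_smul]
    rfl
  inv_hom_id := by
    ext1
    refine ContinuousLinearMap.ext fun v => ?_
    simp

/-- The operations of the autonomous category of Banach spaces: the projective tensor product
with unit `ℝ` and its usual structure maps, and the spaces of bounded operators. -/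
def autonomousData : AutonomousData Ban.{u} where
  tensor :=
    { tensorObj := tensor
      whiskerLeft := fun V _ _ T => tensorMap (𝟙 V) T
      whiskerRight := fun T U => tensorMap T (𝟙 U)
      tensorHom := tensorMap
      tensorUnit := unit
      associator := associator
      leftUnitor := leftUnitor
      rightUnitor := fun V => braiding V unit ≪≫ leftUnitor V }
  braiding := braiding
  ihom := ihom
  curry := curry

end Ban

end

noncomputable section

namespace Ban

/-! ### Monoidal structure -/

/-! The projective tensor product linearizes bounded bilinear maps without changing their norm, and
everything follows from this. Since elementary tensors span a dense subspace, a short operator out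
of an iterated tensor product is determined by its values on them. Hence naturality, pentagon,
triangle and hexagons reduce to one-line computations with elementary tensors (`hom_ext_tmul`,
`op_ext₃`, `op_ext₃'`, `op_ext₄`), and currying is the hom-set bijection of the adjunction.

For the metric, `norm_compL_comp_tmul` says that an operator and the bilinear map it induces have
equal norms. So currying is an isometry, and a norm on a tensor product can be bounded on elementary
tensors alone (`opNorm_le_of_tmul`). Non-expansiveness of composition and of the tensor then comes
from changing one factor at a time, the other factor being short. -/

/-- Short operators on a left-associated fourfold tensor product are determined by their values
on elementary tensors. -/
theorem op_ext₄ {V U W Z X : Ban.{u}} {S T : tensor (tensor (tensor V U) W) Z ⟶ X}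
    (h : ∀ x y z t, S.clm (tmul _ _ (tmul _ _ (tmul _ _ x y) z) t) =
      T.clm (tmul _ _ (tmul _ _ (tmul _ _ x y) z) t)) : S = T := by
  refine (curry _ _ _).injective (op_ext₃ fun x y z => ?_)
  exact ContinuousLinearMap.ext fun t => h x y z t

theorem hom_ext_tmul {V U X : Ban.{u}} {S T : tensor V U ⟶ X}
    (h : ∀ x y, S.clm (tmul _ _ x y) = T.clm (tmul _ _ x y)) : S = T :=
  hom_ext (op_ext h)

@[simp] theorem associator_hom (V U W : Ban.{u}) : (associator V U W).hom = assocHom V U W := rfl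

@[simp] theorem leftUnitor_hom (V : Ban.{u}) : (leftUnitor V).hom = leftUnitorHom V := rfl

@[simp] theorem braiding_hom (V U : Ban.{u}) : (braiding V U).hom = swap V U := rfl

@[simp] theorem associator_inv (V U W : Ban.{u}) : (associator V U W).inv = assocInv V U W := rfl

theorem tensorMap_id (V U : Ban.{u}) : tensorMap (𝟙 V) (𝟙 U) = 𝟙 (tensor V U) :=
  hom_ext_tmul fun x y => by simp

theorem tensorMap_comp {V V' V'' U U' U'' : Ban.{u}} (S : V ⟶ V') (S' : V' ⟶ V'') (T : U ⟶ U')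
    (T' : U' ⟶ U'') : tensorMap S T ≫ tensorMap S' T' = tensorMap (S ≫ S') (T ≫ T') :=
  hom_ext_tmul fun x y => by simp

theorem associator_naturality {V V' U U' W W' : Ban.{u}} (R : V ⟶ V') (S : U ⟶ U')
    (T : W ⟶ W') : tensorMap (tensorMap R S) T ≫ (associator _ _ _).hom =
      (associator _ _ _).hom ≫ tensorMap R (tensorMap S T) :=
  op_ext₃ fun x y z => by simp

theorem leftUnitor_naturality {V U : Ban.{u}} (T : V ⟶ U) :
    tensorMap (𝟙 unit) T ≫ (leftUnitor U).hom = (leftUnitor V).hom ≫ T :=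
  hom_ext_tmul fun x y => by simp

theorem braiding_naturality {V V' U U' : Ban.{u}} (S : V ⟶ V') (T : U ⟶ U') :
    tensorMap S T ≫ (braiding _ _).hom = (braiding _ _).hom ≫ tensorMap T S :=
  hom_ext_tmul fun x y => by simp

theorem pentagon (V U W Z : Ban.{u}) :
    tensorMap (associator V U W).hom (𝟙 Z) ≫ (associator V (tensor U W) Z).hom ≫
        tensorMap (𝟙 V) (associator U W Z).hom =
      (associator (tensor V U) W Z).hom ≫ (associator V U (tensor W Z)).hom :=
  op_ext₄ fun x y z t => by simp

/-- On `(x ⊗ r) ⊗ y` the two sides give `x ⊗ r y` and `r x ⊗ y`, which agree by bilinearity. -/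
theorem triangle (V U : Ban.{u}) :
    (associator V unit U).hom ≫ tensorMap (𝟙 V) (leftUnitor U).hom =
      tensorMap (braiding V unit ≪≫ leftUnitor V).hom (𝟙 U) :=
  op_ext₃ fun x r y => by simp

theorem hexagon_forward (V U W : Ban.{u}) :
    (associator V U W).hom ≫ (braiding V (tensor U W)).hom ≫ (associator U W V).hom =
      tensorMap (braiding V U).hom (𝟙 W) ≫ (associator U V W).hom ≫
        tensorMap (𝟙 U) (braiding V W).hom :=
  op_ext₃ fun x y z => by simp

/-- The source is bracketed to the right, so the test elements are `x ⊗ (y ⊗ z)`, on which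
`assocInv` is known. -/
theorem hexagon_reverse (V U W : Ban.{u}) :
    (associator V U W).inv ≫ (braiding (tensor V U) W).hom ≫ (associator W V U).inv =
      tensorMap (𝟙 V) (braiding U W).hom ≫ (associator V W U).inv ≫
        tensorMap (braiding V W).hom (𝟙 U) :=
  op_ext₃' fun x y z => by simp

/-- The monoidal category of Banach spaces with the projective tensor product. -/
abbrev monoidalCategory : MonoidalCategory Ban.{u} where
  __ := autonomousData.tensor
  tensorHom_def S T := by
    change tensorMap S T = tensorMap S (𝟙 _) ≫ tensorMap (𝟙 _) T
    rw [tensorMap_comp, Category.comp_id, Category.id_comp]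
  id_tensorHom_id := tensorMap_id
  tensorHom_comp_tensorHom S T S' T' := tensorMap_comp S S' T T'
  whiskerLeft_id := tensorMap_id
  id_whiskerRight := tensorMap_id
  associator_naturality := associator_naturality
  leftUnitor_naturality := leftUnitor_naturality
  rightUnitor_naturality {V U} T := by
    -- The right unitor is the braiding followed by the left unitor, so its naturality is inherited
    -- from these two.
    change tensorMap T (𝟙 unit) ≫ (braiding U unit).hom ≫ (leftUnitor U).hom =
      ((braiding V unit).hom ≫ (leftUnitor V).hom) ≫ T
    rw [← Category.assoc, braiding_naturality, Category.assoc, leftUnitor_naturality,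
      Category.assoc]
  pentagon := pentagon
  triangle := triangle

/-- The symmetry of the projective tensor product. -/
abbrev symmetricCategory : @SymmetricCategory Ban.{u} _ monoidalCategory :=
  letI := monoidalCategory.{u}
  { braiding := braiding
    braiding_naturality_right := fun V _ _ T => braiding_naturality (𝟙 V) T
    braiding_naturality_left := fun T V => braiding_naturality T (𝟙 V)
    hexagon_forward := hexagon_forward
    hexagon_reverse := hexagon_reverse
    symmetry := fun V U => (braiding V U).hom_inv_id }

/-! ### The closed structure -/

/-- The adjunction `- ⊗̂ V ⊣ V ⊸ -` given by currying. -/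
def tensorHomAdjunction (V : Ban.{u}) :
    letI := monoidalCategory.{u}
    tensorRight V ⊣ ihom V :=
  letI := monoidalCategory.{u}
  Adjunction.mkOfHomEquiv
    { homEquiv := fun U W => curry V U W
      homEquiv_naturality_left_symm := fun {U U' W} f g => by
        refine hom_ext_tmul (X := W) fun x y => ?_
        change ((curry V U W).symm (f ≫ g)).clm (tmul U V x y) =
          (tensorMap f (𝟙 V) ≫ (curry V U' W).symm g).clm (tmul U V x y)
        rw [comp_clm, ContinuousLinearMap.comp_apply, tensorMap_tmul]
        exact (curry_symm_tmul _ x y).trans (curry_symm_tmul g (f.clm x) y).symm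
      -- Currying commutes with postcomposition by definition; only precomposition needs elementary
      -- tensors.
      homEquiv_naturality_right := fun _ _ => rfl }

/-- Lets the prescribed operations and the isometry property be checked on the explicit `curry`. -/
theorem tensorHomAdjunction_homEquiv (V U W : Ban.{u}) :
    letI := monoidalCategory.{u}
    (tensorHomAdjunction V).homEquiv U W = curry V U W := by
  let := monoidalCategory.{u}
  rw [tensorHomAdjunction, Adjunction.mkOfHomEquiv_homEquiv]

/-- The autonomous category of Banach spaces and short operators. -/
def autonomousCategory : AutonomousCategory Ban.{u} where
  monoidal := monoidalCategory
  symmetric := symmetricCategory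
  ihom := ihom
  adj := tensorHomAdjunction

theorem autonomousCategory_data : autonomousCategory.data = autonomousData.{u} := by
  have h : (fun V U W : Ban.{u} => (autonomousCategory.adj V).homEquiv U W) = curry := by
    funext V U W
    exact tensorHomAdjunction_homEquiv V U W
  -- The tensor, braiding and internal hom agree definitionally, so only the currying field is
  -- rewritten.
  exact congrArg (AutonomousData.mk autonomousData.tensor braiding ihom) h

/-! ### The enrichment -/

theorem clm_injective (V U : Ban.{u}) : Function.Injective (fun S : V ⟶ U => S.clm) :=
  fun _ _ h => hom_ext h

/-- The operator norm distance between short operators. -/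
abbrev homMetricSpace (V U : Ban.{u}) : MetricSpace (V ⟶ U) :=
  MetricSpace.induced _ (clm_injective V U) inferInstance

attribute [local instance] homMetricSpace

theorem edist_eq {V U : Ban.{u}} (S T : V ⟶ U) :
    edist S T = ENNReal.ofReal ‖S.clm - T.clm‖ := by
  rw [edist_dist]
  exact congrArg _ (dist_eq_norm S.clm T.clm)

theorem edist_le_add {V U V' U' V'' U'' : Ban.{u}} {S T : V ⟶ U} {S' T' : V' ⟶ U'}
    {S'' T'' : V'' ⟶ U''}
    (h : ‖S.clm - T.clm‖ ≤ ‖S'.clm - T'.clm‖ + ‖S''.clm - T''.clm‖) :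
    edist S T ≤ edist S' T' + edist S'' T'' := by
  simp only [edist_eq]
  rw [← ENNReal.ofReal_add (norm_nonneg _) (norm_nonneg _)]
  exact ENNReal.ofReal_le_ofReal h

theorem norm_clm_apply_le {V U : Ban.{u}} (S : V ⟶ U) (v : V) : ‖S.clm v‖ ≤ ‖v‖ := by
  simpa using S.clm.le_of_opNorm_le S.short v

/-- Telescoping: `TS - T'S' = T(S - S') + (T - T')S'`, where `T` and `S'` have norm at most `1`. -/
theorem norm_comp_sub_comp_le {V U W : Ban.{u}} (S S' : V ⟶ U) (T T' : U ⟶ W) :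
    ‖(S ≫ T).clm - (S' ≫ T').clm‖ ≤ ‖S.clm - S'.clm‖ + ‖T.clm - T'.clm‖ := by
  have h : (S ≫ T).clm - (S' ≫ T').clm =
      T.clm.comp (S.clm - S'.clm) + (T.clm - T'.clm).comp S'.clm := by
    ext v
    simp
  rw [h]
  refine (norm_add_le _ _).trans (add_le_add ?_ ?_)
  · exact (ContinuousLinearMap.opNorm_comp_le _ _).trans
      (mul_le_of_le_one_left (norm_nonneg _) T.short)
  · exact (ContinuousLinearMap.opNorm_comp_le _ _).trans
      (mul_le_of_le_one_right (norm_nonneg _) S'.short)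

theorem norm_tmul_le (V U : Ban.{u}) (v : V) (w : U) : ‖tmul V U v w‖ ≤ ‖v‖ * ‖w‖ :=
  (tmul V U v).le_of_opNorm_le (tmul_short V U v) w

/-- An operator on the projective tensor product has the norm of the bilinear map it induces. -/
theorem norm_compL_comp_tmul {V U W : Ban.{u}} (D : tensor V U →L[ℝ] W) :
    ‖(ContinuousLinearMap.compL ℝ U (tensor V U) W D).comp (tmul V U)‖ = ‖D‖ := by
  refine le_antisymm ?_ ?_
  · refine ContinuousLinearMap.opNorm_le_bound _ (norm_nonneg _) fun v => ?_
    exact (ContinuousLinearMap.opNorm_comp_le D (tmul V U v)).trans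
      (mul_le_mul_of_nonneg_left (tmul_short _ _ _) (norm_nonneg _))
  -- `D` is the linearization of its own bilinear map, and linearizing does not increase the norm.
  · have h : D = projLift
        ((ContinuousLinearMap.compL ℝ U (tensor V U) W D).comp (tmul V U)) :=
      op_ext fun v w => (projLift_ptmul
        ((ContinuousLinearMap.compL ℝ U (tensor V U) W D).comp (tmul V U)) v w).symm
    conv_lhs => rw [h]
    exact norm_projLift_le _

theorem opNorm_le_of_tmul {V U W : Ban.{u}} (D : tensor V U →L[ℝ] W) {c : ℝ} (hc : 0 ≤ c)
    (h : ∀ v w, ‖D (tmul V U v w)‖ ≤ c * ‖v‖ * ‖w‖) : ‖D‖ ≤ c := by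
  rw [← norm_compL_comp_tmul]
  exact ContinuousLinearMap.opNorm_le_bound₂ _ hc h

theorem norm_tensorMap_sub_tensorMap_le {V V' U U' : Ban.{u}} (S T : V ⟶ V') (S' T' : U ⟶ U') :
    ‖(tensorMap S S').clm - (tensorMap T T').clm‖ ≤ ‖S.clm - T.clm‖ + ‖S'.clm - T'.clm‖ := by
  refine opNorm_le_of_tmul _ (by positivity) fun v w => ?_
  -- Telescoping again: the first factor is changed while `S'` is kept, then the second while `T` is
  -- kept.
  have h : ((tensorMap S S').clm - (tensorMap T T').clm) (tmul V U v w) =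
      tmul V' U' ((S.clm - T.clm) v) (S'.clm w) +
        tmul V' U' (T.clm v) ((S'.clm - T'.clm) w) := by
    simp
  rw [h, add_mul, add_mul]
  refine (norm_add_le _ _).trans (add_le_add ?_ ?_)
  · refine (norm_tmul_le _ _ _ _).trans ?_
    exact mul_le_mul (ContinuousLinearMap.le_opNorm _ _) (norm_clm_apply_le S' w)
      (norm_nonneg _) (by positivity)
  · refine (norm_tmul_le _ _ _ _).trans ?_
    refine (mul_le_mul (norm_clm_apply_le T v) (ContinuousLinearMap.le_opNorm _ _)
      (norm_nonneg _) (norm_nonneg _)).trans_eq (by ring)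

/-- Currying is additive on underlying operators, so the difference of two curried maps is the
bilinear map of `S - T`, which has the same norm. -/
theorem isometry_curry (V U W : Ban.{u}) : Isometry (curry V U W) := fun S T => by
  rw [edist_eq, edist_eq, ← norm_compL_comp_tmul (S.clm - T.clm), map_sub,
    ContinuousLinearMap.sub_comp]
  rfl

/-- The `Met`-enriched autonomous category of Banach spaces and short operators. -/
def metEnrichedAutonomousCategory : MetEnrichedAutonomousCategory Ban.{u} where
  toAutonomousCategory := autonomousCategory
  emetric V U := inferInstance
  edist_comp_le S S' T T' := edist_le_add (norm_comp_sub_comp_le S S' T T')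
  edist_tensorHom_le S T S' T' := edist_le_add (norm_tensorMap_sub_tensorMap_le S T S' T')
  isometry_homEquiv V U W := by
    have h : (autonomousCategory.adj V).homEquiv U W = curry V U W :=
      tensorHomAdjunction_homEquiv V U W
    rw [h]
    exact isometry_curry V U W

end Ban

end

theorem mainTheorem9 :
    ∃ A : MetEnrichedAutonomousCategory Ban.{u},
      A.data = Ban.autonomousData ∧
      ∀ (V U : Ban.{u}) (S T : V ⟶ U),
        (A.emetric V U).edist S T = ENNReal.ofReal ‖S.clm - T.clm‖ :=
  ⟨Ban.metEnrichedAutonomousCategory, Ban.autonomousCategory_data, fun _ _ => Ban.edist_eq⟩
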